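/- Let $n\ge 1$, let $R$ be a commutative ring, and let $A_1,\ldots,A_{2n-1}\in M_{n\times n}(R)$. Write \[ [A_1,\ldots,A_{2n-1}]=\sum_{\pi\in\Sigma_{2n-1}}\mathrm{sgn}(\pi)\,A_{\pi(1)}\cdots A_{\pi(2n-1)} \] for their complete antisymmetrisation. A type of rank $n$ is a subset $\nu\subset\{1,\ldots,n\}\times\{1,\ldots,n\}$ with exactly $2n-1$ elements. Let $p(\nu),q(\nu)\in\mathbb{Z}^n$ be the vectors whose entries $p(\nu)_a$ and $q(\nu)_b$ are the number of pairs in $\nu$ with first entry $a$, respectively with second entry $b$, and let $e_1,\ldots,e_n$ be the standard basis of $\mathbb{Z}^n$. For each type $\nu$ choose an arbitrary ordering $\nu=((i_1,j_1),\ldots,(i_{2n-1},j_{2n-1}))$ of its elements. Let $M_\nu$ be the $(2n-1)\times 2n$ integer matrix whose $k$th row has $-1$ in column $i_k$, $1$ in column $n+j_k$, and $0$ in every other column, and for $1\le s\le 2n$ let $M_\nu^{\emptyset,s}$ be the square matrix obtained from $M_\nu$ by deleting column $s$. Then, for all $1\le i,j\le n$ and every $s\in\{1,\ldots,2n\}$,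 \[ [A_1,\ldots,A_{2n-1}]_{ij}=(-1)^{\binom n2+s-1}\sum_{\nu\,:\,p(\nu)-q(\nu)=e_i-e_j}\det(M_\nu^{\emptyset,s})\Big(\prod_{r=1}^{n}(p(\nu)_r+\delta_{j,r}-1)!\Big)\det\Big((A_r)_{ab}\Big)_{r,(a,b)\in\nu}, \] where the sum is over types $\nu$ of rank $n$, the factorial of a negative integer is defined to be $1$, and the last determinant is that of the $(2n-1)\times(2n-1)$ matrix with entry $(A_r)_{i_kj_k}$ in row $r$ and column $k$. In particular, the right-hand side does not depend on $s$ or on the chosen orderings. -/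

import Mathlib

/-- A type of rank `n`: a set of `2n - 1` ordered pairs of elements of an `n`-element set. -/
abbrev RankType (n : ℕ) : Type :=
  {ν : Finset (Fin n × Fin n) // ν.card = 2 * n - 1}

/-- An ordering of the elements of the type `ν`: position `k` holds the pair `(i_k, j_k)`. -/
abbrev RankType.Ordering {n : ℕ} (ν : RankType n) : Type :=
  Fin (2 * n - 1) ≃ {x : Fin n × Fin n // x ∈ ν.1}

/-- The weight `p(ν)_a`: the number of pairs of `ν` with first entry `a`. -/
def RankType.p {n : ℕ} (ν : RankType n) (a : Fin n) : ℕ :=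
  (ν.1.filter (fun x => x.1 = a)).card

/-- The weight `q(ν)_b`: the number of pairs of `ν` with second entry `b`. -/
def RankType.q {n : ℕ} (ν : RankType n) (b : Fin n) : ℕ :=
  (ν.1.filter (fun x => x.2 = b)).card

/-- The `(2n - 1) × 2n` matrix `M_ν`: the row of the pair `(i, j)` has `-1` in column `i`,
`1` in column `n + j` and `0` elsewhere. -/
def RankType.incMatrix {n : ℕ} (ν : RankType n) (e : ν.Ordering) :
    Matrix (Fin (2 * n - 1)) (Fin (2 * n)) ℤ :=
  Matrix.of fun k c =>
    if (c : ℕ) = ((e k).1.1 : ℕ) then -1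
    else if (c : ℕ) = n + ((e k).1.2 : ℕ) then 1
    else 0

/-- The increasing enumeration of the columns `0, …, 2n - 1` other than column `s`. -/
def skipColumn {n : ℕ} (s : Fin (2 * n)) (c : Fin (2 * n - 1)) : Fin (2 * n) :=
  if (c : ℕ) < (s : ℕ) then ⟨c, by omega⟩ else ⟨c + 1, by omega⟩

/-- The square matrix obtained from `M_ν` by deleting column `s`. -/
def RankType.incMinor {n : ℕ} (ν : RankType n) (e : ν.Ordering) (s : Fin (2 * n)) :
    Matrix (Fin (2 * n - 1)) (Fin (2 * n - 1)) ℤ :=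
  (ν.incMatrix e).submatrix id (skipColumn s)

/-- The factorial of an integer, with value `1` on negative integers. -/
def intFactorial (z : ℤ) : ℕ := z.toNat.factorial

/-- The `(2n - 1) × (2n - 1)` matrix whose entry in row `r` and in the column of `(a, b) ∈ ν` is
`(A_r)_{ab}`. -/
def RankType.entryMatrix {n : ℕ} {R : Type*} (ν : RankType n) (e : ν.Ordering)
    (A : Fin (2 * n - 1) → Matrix (Fin n) (Fin n) R) :
    Matrix (Fin (2 * n - 1)) (Fin (2 * n - 1)) R :=
  Matrix.of fun r c => A r (e c).1.1 (e c).1.2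

/-- The complete antisymmetrisation `[A_1, …, A_k] = ∑_π sgn(π) A_{π(1)} ⋯ A_{π(k)}`. -/
def antisymmetrisation {n k : ℕ} {R : Type*} [CommRing R]
    (A : Fin k → Matrix (Fin n) (Fin n) R) : Matrix (Fin n) (Fin n) R :=
  ∑ π : Equiv.Perm (Fin k),
    ((Equiv.Perm.sign π : ℤˣ) : ℤ) • (List.ofFn fun t => A (π t)).prod

/-! Put X = ∑ A_r ξ_r over the exterior algebra on generators ξ_1, …, ξ_{2n-1}. The top coefficient
of X^{2n-1} is the antisymmetrisation (`map_pow_ι_eq_antisymmetrisation`), so the theorem is a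
computation of this power. The entries of X anticommute, so Y = X² has central entries. Cyclicity of
the trace then holds with a sign, which gives tr Y^k = -tr Y^k = 0 for k ≥ 1. In the absence of
torsion the characteristic polynomial of Y is therefore t^n, so adj Y = (-1)^{n-1} Y^{n-1} and
X^{2n-1} = (-1)^{n-1} X adj(X²) (`pow_eq_mul_adjugate_of_anticommute`). Expanding X adj(X²) gives a
sum over permutations and over the intermediate indices of the products X². Its terms are
determinants of entries of the A_r. Permutations giving the same positions are counted by a product
of factorials, which vanishes unless p(ν) - q(ν) = e_i - e_j (`card_filter_perm_eq_positionWeight`).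
The constraint on the positions is a product of entries of M_ν with column j deleted, so a weighted
Cauchy–Binet formula collects the terms by types. Other columns s follow because the rows of M_ν sum
to zero. Arbitrary rings follow from generic matrices over ℤ, whose polynomial ring embeds in the
one over ℚ. -/

/-! ### Adjugates of matrices with traceless powers -/

open Matrix Polynomial in
/-- Jacobi's formula for the derivative of the determinant of a polynomial matrix. -/
theorem derivative_det_eq_trace_adjugate_mul {S ι : Type*} [CommRing S] [Fintype ι] [DecidableEq ι]
    (M : Matrix ι ι S[X]) :
    derivative M.det = (M.adjugate * M.map derivative).trace := by
  -- By Cramer's rule, each diagonal entry is the determinant with one column differentiated.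
  have key : ∀ k, (M.adjugate * M.map derivative) k k
      = (M.updateCol k fun i => derivative (M i k)).det := by
    intro k
    rw [← cramer_apply, cramer_eq_adjugate_mulVec]
    simp [Matrix.mul_apply, mulVec, dotProduct]
  simp only [Matrix.trace, Matrix.diag, key, det_apply', derivative_sum]
  rw [Finset.sum_comm]
  refine Finset.sum_congr rfl fun σ _ => ?_
  rw [derivative_mul, derivative_intCast, zero_mul, zero_add, derivative_prod_finset,
    Finset.mul_sum]
  refine Finset.sum_congr rfl fun k _ => ?_
  rw [← Finset.prod_erase_mul _ _ (Finset.mem_univ k)]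
  congr 2
  · exact Finset.prod_congr rfl fun l hl => by
      rw [updateCol_ne (Finset.ne_of_mem_erase hl)]
  · simp

open Matrix Polynomial in
/-- A square matrix all of whose powers are traceless has adjugate equal, up to sign, to its
largest power that need not vanish. -/
theorem adjugate_eq_pow_of_trace_pow_eq_zero {S : Type*} [CommRing S]
    (hS : ∀ k : ℕ, k ≠ 0 → ∀ x : S, (k : S) * x = 0 → x = 0) {m : ℕ}
    (Y : Matrix (Fin (m + 1)) (Fin (m + 1)) S) (hY : ∀ k, (Y ^ (k + 1)).trace = 0) :
    Y.adjugate = (-1) ^ m • Y ^ m := by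
  nontriviality S
  -- `B k` is the coefficient of t^k in adj(t - Y). Comparing coefficients in (t - Y) adj(t - Y) =
  -- χ(t) gives `hrec`, and Jacobi's formula tr adj(t - Y) = χ'(t) gives `htr`.
  set B : ℕ → Matrix (Fin (m + 1)) (Fin (m + 1)) S :=
    fun k => Matrix.of fun i j => (adjugate (charmatrix Y) i j).coeff k with hB
  have hmul := mul_adjugate (charmatrix Y)
  change _ = Y.charpoly • _ at hmul
  have hrec : ∀ k, B k = Y * B (k + 1) + Y.charpoly.coeff (k + 1) • 1 := by
    intro k
    ext i j
    have h := congrArg (fun M => (M i j).coeff (k + 1)) hmul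
    simp only [hB]
    generalize adjugate (charmatrix Y) = Q at h ⊢
    simp only [charmatrix, sub_mul, RingHom.mapMatrix_apply, Matrix.sub_apply, coeff_sub] at h
    rw [scalar_apply, Matrix.diagonal_mul, coeff_X_mul] at h
    simp only [Matrix.mul_apply, Matrix.map_apply, finsetSum_coeff, coeff_C_mul,
      Matrix.smul_apply, smul_eq_mul, Matrix.one_apply, mul_ite, mul_one, mul_zero] at h
    rw [sub_eq_iff_eq_add] at h
    simp only [Matrix.add_apply, Matrix.mul_apply, Matrix.of_apply, h, Matrix.smul_apply,
      Matrix.one_apply, smul_eq_mul, mul_ite, mul_one, mul_zero]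
    refine (add_comm _ _).trans (congrArg₂ _ rfl ?_)
    split_ifs <;> simp
  have htr : ∀ k, (B k).trace = Y.charpoly.coeff (k + 1) * ((k : S) + 1) := by
    intro k
    have h := derivative_det_eq_trace_adjugate_mul (charmatrix Y)
    have h1 : (charmatrix Y).map derivative = 1 := by
      ext i j : 2
      by_cases hij : i = j <;> simp [charmatrix, hij, Matrix.one_apply]
    rw [h1, mul_one] at h
    have h2 := congrArg (fun p => p.coeff k) h
    simp only [coeff_derivative, Matrix.trace, Matrix.diag, finsetSum_coeff] at h2
    exact h2.symm
  have hdeg : Y.charpoly.natDegree = m + 1 := by simp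
  have hzero : ∀ k, m + 1 ≤ k → B k = 0 := by
    -- A crude degree bound starts a downward induction along `hrec`.
    obtain ⟨d, hd⟩ : ∃ d, ∀ k, d ≤ k → B k = 0 := by
      refine ⟨(Finset.univ.sup fun i => Finset.univ.sup fun j =>
        (adjugate (charmatrix Y) i j).natDegree) + 1, fun k hk => ?_⟩
      ext i j
      refine coeff_eq_zero_of_natDegree_lt (lt_of_lt_of_le (Nat.lt_succ_of_le ?_) hk)
      exact (Finset.le_sup (f := fun j => (adjugate (charmatrix Y) i j).natDegree)
        (Finset.mem_univ j)).trans (Finset.le_sup (f := fun i => Finset.univ.sup fun j =>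
        (adjugate (charmatrix Y) i j).natDegree) (Finset.mem_univ i))
    intro k hk
    by_cases hkd : d ≤ k
    · exact hd k hkd
    · obtain ⟨r, hr⟩ : ∃ r, r = d - k := ⟨_, rfl⟩
      induction r generalizing k with
      | zero => exact hd k (by omega)
      | succ r ih =>
        have h1 : B (k + 1) = 0 := by
          by_cases h : d ≤ k + 1
          · exact hd _ h
          · exact ih (k + 1) (by omega) h (by omega)
        rw [hrec, h1, mul_zero, coeff_eq_zero_of_natDegree_lt (by omega)]
        simp
  have hpow : ∀ r, r ≤ m → B (m - r) = Y ^ r := by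
    intro r
    induction r with
    | zero =>
      intro _
      rw [hrec, Nat.sub_zero, hzero _ le_rfl, mul_zero, zero_add, pow_zero]
      have : Y.charpoly.coeff (m + 1) = 1 := by
        have := (charpoly_monic Y).coeff_natDegree
        rwa [hdeg] at this
      rw [this, one_smul]
    | succ r ih =>
      intro hr
      have h1 := ih (by omega)
      have h2 := hrec (m - (r + 1))
      have h3 := htr (m - (r + 1))
      rw [show m - (r + 1) + 1 = m - r by omega] at h2 h3
      rw [h1, ← pow_succ'] at h2
      rw [h2, trace_add, hY, trace_smul, trace_one, zero_add, smul_eq_mul] at h3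
      -- The trace of `hrec` gives (m + 1) c = (m - r) c for this coefficient c, that is (r + 1) c =
      -- 0.
      have h4 : Y.charpoly.coeff (m - r) = 0 := by
        refine hS (r + 1) (by omega) _ ?_
        have h5 : ((m - (r + 1) : ℕ) : S) + 1 + ((r + 1 : ℕ) : S)
            = (Fintype.card (Fin (m + 1)) : S) := by
          rw [Fintype.card_fin]
          norm_cast
          congr 1
          omega
        rw [← h5] at h3
        linear_combination h3
      rw [h2, h4, zero_smul, add_zero]
  have h0 : B 0 = (-Y).adjugate := by
    have h := RingHom.map_adjugate (evalRingHom (0 : S)) (charmatrix Y)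
    have h1 : (evalRingHom (0 : S)).mapMatrix (charmatrix Y) = -Y := by
      ext i j
      by_cases hij : i = j <;> simp [charmatrix, hij]
    rw [h1] at h
    rw [← h]
    ext i j
    simp [hB, coeff_zero_eq_eval_zero]
  have h1 := hpow m le_rfl
  rw [Nat.sub_self, h0, ← neg_one_smul S Y, adjugate_smul, Fintype.card_fin,
    Nat.add_sub_cancel] at h1
  rw [← h1, ← Int.cast_smul_eq_zsmul S]
  simp [smul_smul, ← mul_pow]

/-! ### Matrices with anticommuting entries -/

/-- An odd power of a matrix with anticommuting entries, expressed by the adjugate of the square of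
the matrix, which has central entries. -/
theorem pow_eq_mul_adjugate_of_anticommute {Λ : Type*} [Ring Λ]
    (hΛ : ∀ k : ℕ, k ≠ 0 → ∀ x : Λ, (k : Λ) * x = 0 → x = 0) {m : ℕ}
    (X : Matrix (Fin (m + 1)) (Fin (m + 1)) Λ)
    (hX : ∀ a b c d, X a b * X c d = -(X c d * X a b))
    (Y : Matrix (Fin (m + 1)) (Fin (m + 1)) (Subring.center Λ))
    (hY : (Subring.center Λ).subtype.mapMatrix Y = X * X) :
    X ^ (2 * m + 1) = (-1) ^ m • (X * (Subring.center Λ).subtype.mapMatrix Y.adjugate) := by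
  have htr : ∀ k, (Y ^ (k + 1)).trace = 0 := by
    intro k
    set P := (Subring.center Λ).subtype.mapMatrix (Y ^ k) with hP
    have hPX : P = X ^ (2 * k) := by rw [hP, map_pow, hY, ← pow_two, ← pow_mul]
    have h1 : (Subring.center Λ).subtype (Y ^ (k + 1)).trace = (X * (X * P)).trace := by
      rw [AddMonoidHom.map_trace, pow_succ', ← mul_assoc, ← hY]
      exact congrArg Matrix.trace (map_mul (Subring.center Λ).subtype.mapMatrix _ _)
    -- The entries of P are central, so exchanging X and XP under the trace costs exactly one sign.
    -- Both products are the same power of X, hence twice the trace is zero.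
    have h2 : (X * (X * P)).trace = -((X * P) * X).trace := by
      simp only [Matrix.trace, Matrix.diag]
      simp only [Matrix.mul_apply (M := X) (N := X * P),
        Matrix.mul_apply (M := X * P) (N := X)]
      rw [Finset.sum_comm, ← Finset.sum_neg_distrib]
      refine Finset.sum_congr rfl fun b _ => ?_
      rw [← Finset.sum_neg_distrib]
      refine Finset.sum_congr rfl fun a _ => ?_
      rw [Matrix.mul_apply, Finset.mul_sum, Finset.sum_mul, ← Finset.sum_neg_distrib]
      refine Finset.sum_congr rfl fun c _ => ?_
      have hc : ∀ g, g * P c a = P c a * g := Subring.mem_center_iff.mp ((Y ^ k) c a).2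
      rw [← mul_assoc, hX, neg_mul, mul_assoc, hc, mul_assoc]
    have h3 : (X * P) * X = X * (X * P) := by
      rw [hPX, ← pow_succ', ← pow_succ, ← pow_succ']
    rw [h3] at h2
    have h4 : (X * (X * P)).trace = 0 := by
      refine hΛ 2 two_ne_zero _ ?_
      push_cast
      rw [two_mul]
      nth_rewrite 1 [h2]
      exact neg_add_cancel _
    exact Subtype.ext (h1.trans h4)
  have hS : ∀ k : ℕ, k ≠ 0 → ∀ x : Subring.center Λ, (k : Subring.center Λ) * x = 0 → x = 0 := by
    intro k hk x hx
    refine Subtype.ext (hΛ k hk x ?_)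
    simpa using congrArg Subtype.val hx
  have hadj := adjugate_eq_pow_of_trace_pow_eq_zero hS Y htr
  rw [hadj, map_zsmul, map_pow, hY, mul_smul_comm, smul_smul, ← mul_pow, ← pow_two X, ← pow_mul,
    ← pow_succ']
  simp

/-- Moving the first factors of a product of pairs of anticommuting elements to the front. -/
theorem mul_prod_ofFn_mul_of_anticommute {Λ : Type*} [Ring Λ] {m : ℕ} (u : Fin m → Λ)
    (w : Fin (m + 1) → Λ) (h : ∀ k l, w k * u l = -(u l * w k)) :
    w 0 * (List.ofFn fun k => u k * w k.succ).prod =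
      (-1) ^ (m + 1).choose 2 * ((List.ofFn u).prod * (List.ofFn w).prod) := by
  -- Each `u k` passes `w 0`, …, `w k`, which costs k + 1 signs, and 1 + … + m = (m + 1).choose 2.
  induction m with
  | zero => simp
  | succ m ih =>
    have hmove : ∀ (r : ℕ) (v : Fin r → Λ) (y : Λ), (∀ k, v k * y = -(y * v k)) →
        (List.ofFn v).prod * y = (-1) ^ r * (y * (List.ofFn v).prod) := by
      intro r
      induction r with
      | zero => simp
      | succ r ih =>
        intro v y hv
        rw [List.ofFn_succ, List.prod_cons, mul_assoc, ih (fun i => v i.succ) y fun k => hv _]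
        rw [← mul_assoc, ← ((Commute.neg_one_left (v 0)).pow_left r).eq, mul_assoc,
          ← mul_assoc (v 0), hv 0, pow_succ]
        simp [mul_assoc]
    have h1 := ih (fun k => u k.castSucc) (fun k => w k.castSucc) (fun k l => h _ _)
    rw [List.ofFn_succ', List.prod_concat, ← mul_assoc]
    simp only [Fin.castSucc_zero, ← Fin.succ_castSucc] at h1 ⊢
    rw [h1, List.ofFn_succ' u, List.prod_concat, List.ofFn_succ' w, List.prod_concat,
      mul_assoc, mul_assoc, ← mul_assoc _ (u (Fin.last m)),
      hmove _ _ (u (Fin.last m)) fun k => h _ _, Nat.choose_succ_succ' (m + 1) 1,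
      Nat.choose_one_right, pow_add]
    have hc : ∀ (y z : Λ) (r : ℕ), y * ((-1) ^ r * z) = (-1) ^ r * (y * z) := fun y z r => by
      rw [← mul_assoc, ← ((Commute.neg_one_left y).pow_left r).eq, mul_assoc]
    simp only [mul_assoc, Fin.succ_last]
    rw [← mul_assoc ((-1) ^ m), ← pow_add, hc, ← mul_assoc, ← pow_add, add_comm]

/-! ### The exterior algebra and its top coefficient -/

/-- This functional extracts the top coefficient: it is induced by the determinant in degree N and
by zero in every other degree. -/
theorem ExteriorAlgebra.exists_linearMap_prod_ι_eq_det (K : Type*) [CommRing K] (N : ℕ) :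
    ∃ φ : ExteriorAlgebra K (Fin N → K) →ₗ[K] K, ∀ v : Fin N → Fin N → K,
      φ (List.ofFn fun t => ExteriorAlgebra.ι K (v t)).prod = (Matrix.of v).det := by
  refine ⟨ExteriorAlgebra.liftAlternating (Pi.single N Matrix.detRowAlternating), fun v => ?_⟩
  rw [← ExteriorAlgebra.ιMulti_apply, ExteriorAlgebra.liftAlternating_apply_ιMulti, Pi.single_eq_same]
  rfl

/-- A generator passing two factors of degree one picks up two signs, which cancel. This lets X² be
treated as a matrix over a commutative ring. -/
theorem ExteriorAlgebra.ι_mul_ι_mem_center {K V : Type*} [CommRing K] [AddCommGroup V] [Module K V]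
    (u v : V) : ExteriorAlgebra.ι K u * ExteriorAlgebra.ι K v ∈
      Subring.center (ExteriorAlgebra K V) := by
  rw [Subring.mem_center_iff]
  have hsw : ∀ x y : V, ExteriorAlgebra.ι K x * ExteriorAlgebra.ι K y
      = -(ExteriorAlgebra.ι K y * ExteriorAlgebra.ι K x) := fun x y =>
    eq_neg_of_add_eq_zero_left (ExteriorAlgebra.ι_add_mul_swap x y)
  intro g
  induction g using ExteriorAlgebra.induction with
  | algebraMap r => exact Algebra.commutes _ _
  | ι x => rw [← mul_assoc, hsw x u, neg_mul, mul_assoc, hsw x v, mul_neg, neg_neg, mul_assoc]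
  | mul a b ha hb => rw [mul_assoc, hb, ← mul_assoc, ha, mul_assoc]
  | add a b ha hb => rw [add_mul, mul_add, ha, hb]

theorem Matrix.list_prod_ofFn_map_smul_apply {K Λ ι : Type*} [CommRing K] [Ring Λ] [Algebra K Λ]
    [Fintype ι] [DecidableEq ι] (k : ℕ) (B : Fin k → Matrix ι ι K) (ξ : Fin k → Λ) (a b : ι) :
    (List.ofFn fun t => (B t).map fun y => y • ξ t).prod a b =
      (List.ofFn B).prod a b • (List.ofFn ξ).prod := by
  induction k generalizing a with
  | zero => simp [Matrix.one_apply]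
  | succ k ih =>
    simp only [List.ofFn_succ, List.prod_cons, Matrix.mul_apply, ih, Finset.sum_smul,
      Matrix.map_apply, smul_mul_smul_comm]

theorem det_of_single_eq_zero {K : Type*} [CommRing K] {N : ℕ} {w : Fin N → Fin N}
    (hw : ¬ Function.Injective w) :
    (Matrix.of fun t => (Pi.single (w t) 1 : Fin N → K)).det = 0 := by
  simp only [Function.Injective, not_forall] at hw
  obtain ⟨a, b, hab, hne⟩ := hw
  exact Matrix.det_zero_of_row_eq hne (funext fun c => by rw [Matrix.of_apply, Matrix.of_apply, hab])

/-- A power of a matrix over the exterior algebra whose entries have degree one has the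
antisymmetrisation of the coefficient matrices as its top coefficient. -/
theorem map_pow_ι_eq_antisymmetrisation {K : Type*} [CommRing K] {N n : ℕ}
    (φ : ExteriorAlgebra K (Fin N → K) →ₗ[K] K)
    (hφ : ∀ v : Fin N → Fin N → K,
      φ (List.ofFn fun t => ExteriorAlgebra.ι K (v t)).prod = (Matrix.of v).det)
    (A : Fin N → Matrix (Fin n) (Fin n) K) (i j : Fin n) :
    φ (((Matrix.of fun a b => ExteriorAlgebra.ι K fun r => A r a b) ^ N) i j) =
      antisymmetrisation A i j := by
  have hX : (Matrix.of fun a b => ExteriorAlgebra.ι K fun r => A r a b) =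
      ∑ r, (A r).map fun y => y • ExteriorAlgebra.ι K (Pi.single r 1 : Fin N → K) := by
    ext a b
    rw [Matrix.sum_apply]
    simp only [Matrix.of_apply, Matrix.map_apply, ← map_smul, ← map_sum]
    congr 1
    ext r
    simp [Finset.sum_apply, Pi.single_apply]
  have hpow := (MultilinearMap.mkPiAlgebraFin ℤ N
    (Matrix (Fin n) (Fin n) (ExteriorAlgebra K (Fin N → K)))).map_sum
    (fun (_ : Fin N) r => (A r).map fun y => y • ExteriorAlgebra.ι K (Pi.single r 1 : Fin N → K))
  simp only [MultilinearMap.mkPiAlgebraFin_apply, List.ofFn_const, List.prod_replicate] at hpow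
  rw [hX, hpow, Matrix.sum_apply, map_sum, antisymmetrisation, Matrix.sum_apply]
  simp only [Matrix.list_prod_ofFn_map_smul_apply, map_smul, hφ]
  symm
  -- Only the injective words in the generators survive, and these are the permutations.
  refine Fintype.sum_of_injective (fun π : Equiv.Perm (Fin N) => (π : Fin N → Fin N))
    DFunLike.coe_injective _ _ ?_ ?_
  · intro w hw
    rw [det_of_single_eq_zero, smul_zero]
    exact fun h => hw ⟨Equiv.ofBijective w (Finite.injective_iff_bijective.mp h), rfl⟩
  · intro π
    have h := Matrix.det_permute π (1 : Matrix (Fin N) (Fin N) K)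
    have h1 : (Matrix.of fun t => (Pi.single (π t) 1 : Fin N → K)) =
        (1 : Matrix (Fin N) (Fin N) K).submatrix π id := by
      ext a b
      simp [Matrix.one_apply, Pi.single_apply, eq_comm]
    rw [h1, h, Matrix.smul_apply, Matrix.det_one, mul_one, smul_eq_mul, zsmul_eq_mul, mul_comm]

/-! ### Expansion into determinants of entries -/

/-- The determinant whose rows hold the entries of the matrices `A r` at the positions `w`. -/
def positionDet {K : Type*} [CommRing K] {N n : ℕ} {ι : Type*} (κ : Fin N ≃ ι)
    (A : Fin N → Matrix (Fin n) (Fin n) K) (w : ι → Fin n × Fin n) : K :=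
  (Matrix.of fun t r => A r (w (κ t)).1 (w (κ t)).2).det

theorem positionDet_comp_perm {K : Type*} [CommRing K] {N n : ℕ} {ι : Type*} [Fintype ι]
    [DecidableEq ι] (κ : Fin N ≃ ι)
    (A : Fin N → Matrix (Fin n) (Fin n) K) (w : ι → Fin n × Fin n) (π : Equiv.Perm ι) :
    positionDet κ A (w ∘ π) = Equiv.Perm.sign π * positionDet κ A w := by
  have h := Matrix.det_permute (κ.symm.permCongr π)
    (Matrix.of fun t r => A r (w (κ t)).1 (w (κ t)).2)
  rw [Equiv.Perm.sign_permCongr] at h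
  rw [positionDet, positionDet, ← h]
  congr 1
  ext t r
  simp [Equiv.permCongr_apply]

/-- The positions `(j.succAbove k, f k)` for `k < m`, followed by the positions `(F b, b)`, where
`F` is `i` followed by `f`, permuted by `σ`. -/
def transversalPositions {m : ℕ} (i j : Fin (m + 1)) (f : Fin m → Fin (m + 1))
    (σ : Equiv.Perm (Fin (m + 1))) : Fin m ⊕ Fin (m + 1) → Fin (m + 1) × Fin (m + 1) :=
  Sum.elim (fun k => (j.succAbove k, f k))
    (fun b => ((Fin.cons i f : Fin (m + 1) → Fin (m + 1)) (σ b), b))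

open ExteriorAlgebra in
/-- The antisymmetrisation as a signed sum over permutations and functions. -/
theorem antisymmetrisation_eq_sum_transversalPositions {K : Type*} [CommRing K] [Algebra ℚ K]
    {m N : ℕ} (hN : m + (m + 1) = N) (A : Fin N → Matrix (Fin (m + 1)) (Fin (m + 1)) K)
    (i j : Fin (m + 1)) :
    antisymmetrisation A i j = (-1) ^ ((m + 1).choose 2 + j + m) *
      ∑ f : Fin m → Fin (m + 1), ∑ σ : Equiv.Perm (Fin (m + 1)),
        positionDet ((finCongr hN.symm).trans finSumFinEquiv.symm) A
          (transversalPositions i j f σ) := by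
  obtain ⟨φ, hφ⟩ := exists_linearMap_prod_ι_eq_det K N
  rw [← map_pow_ι_eq_antisymmetrisation φ hφ]
  set x : Fin (m + 1) → Fin (m + 1) → ExteriorAlgebra K (Fin N → K) :=
    fun a b => ι K fun r => A r a b with hx
  have hanti : ∀ a b c d, x a b * x c d = -(x c d * x a b) := fun a b c d =>
    eq_neg_of_add_eq_zero_left (ι_add_mul_swap _ _)
  set z : Fin (m + 1) → Fin (m + 1) → Fin (m + 1) →
      Subring.center (ExteriorAlgebra K (Fin N → K)) :=
    fun a c b => ⟨x a c * x c b, ι_mul_ι_mem_center _ _⟩ with hz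
  set Y : Matrix (Fin (m + 1)) (Fin (m + 1))
    (Subring.center (ExteriorAlgebra K (Fin N → K))) := Matrix.of fun a b => ∑ c, z a c b with hY
  have hYX : (Subring.center (ExteriorAlgebra K (Fin N → K))).subtype.mapMatrix Y =
      Matrix.of x * Matrix.of x := by
    ext a b
    rw [RingHom.mapMatrix_apply, Matrix.map_apply, hY, Matrix.of_apply, map_sum, Matrix.mul_apply]
    rfl
  have htf : ∀ k : ℕ, k ≠ 0 → ∀ y : ExteriorAlgebra K (Fin N → K),
      (k : ExteriorAlgebra K (Fin N → K)) * y = 0 → y = 0 := by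
    intro k hk y hy
    have h1 : ((k : K)) • y = 0 := by
      rw [Algebra.smul_def, map_natCast, hy]
    have h2 : algebraMap ℚ K (k : ℚ)⁻¹ * (k : K) = 1 := by
      rw [← map_natCast (algebraMap ℚ K), ← map_mul, inv_mul_cancel₀ (by exact_mod_cast hk), map_one]
    rw [← one_smul K y, ← h2, mul_smul, h1, smul_zero]
  have hpow := pow_eq_mul_adjugate_of_anticommute htf (Matrix.of x) hanti Y hYX
  -- The adjugate entry is the determinant of Y with row j replaced by the k-th unit vector; `f`
  -- records the intermediate index chosen in each remaining entry of X².
  have hadj : ∀ k, Y.adjugate k j = ∑ σ : Equiv.Perm (Fin (m + 1)),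
      ∑ f : Fin m → Fin (m + 1), ((Equiv.Perm.sign σ : ℤˣ) : ℤ) •
        ((Pi.single k 1 : Fin (m + 1) → _) (σ j) *
          ∏ l, z (j.succAbove l) (f l) (σ (j.succAbove l))) := by
    intro k
    rw [Matrix.adjugate_apply, ← Matrix.det_transpose, Matrix.det_apply]
    refine Finset.sum_congr rfl fun σ _ => ?_
    rw [← Finset.smul_sum, ← Finset.mul_sum, Units.smul_def]
    simp only [Matrix.transpose_apply]
    rw [Fin.prod_univ_succAbove _ j]
    simp only [Matrix.updateRow_self, Matrix.updateRow_ne (Fin.succAbove_ne j _), hY,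
      Matrix.of_apply]
    rw [Finset.prod_univ_sum, Fintype.piFinset_univ]
  have hterm : ∀ σ : Equiv.Perm (Fin (m + 1)), ∀ f : Fin m → Fin (m + 1),
      φ (∑ k, x i k * (Subring.center (ExteriorAlgebra K (Fin N → K))).subtype
        (((Equiv.Perm.sign σ : ℤˣ) : ℤ) • ((Pi.single k 1 : Fin (m + 1) → _) (σ j) *
          ∏ l, z (j.succAbove l) (f l) (σ (j.succAbove l))))) =
      (-1) ^ ((m + 1).choose 2 + j) *
        positionDet ((finCongr hN.symm).trans finSumFinEquiv.symm) A
          (transversalPositions i j f (σ * j.cycleRange.symm)⁻¹) := by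
    intro σ f
    subst hN
    -- The cycle lists row j first and the other rows in order, so that the leading factor from X
    -- joins the second factors of the products. Its sign is (-1)^j.
    set τ := σ * j.cycleRange.symm with hτ
    set u : Fin m → ExteriorAlgebra K (Fin (m + (m + 1)) → K) :=
      fun l => x (j.succAbove l) (f l) with hu
    set w : Fin (m + 1) → ExteriorAlgebra K (Fin (m + (m + 1)) → K) :=
      fun t => x ((Fin.cons i f : Fin (m + 1) → Fin (m + 1)) t) (τ t) with hw
    have h1 : ∑ k, x i k * (Subring.center (ExteriorAlgebra K (Fin (m + (m + 1)) → K))).subtype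
        (((Equiv.Perm.sign σ : ℤˣ) : ℤ) • ((Pi.single k 1 : Fin (m + 1) → _) (σ j) *
          ∏ l, z (j.succAbove l) (f l) (σ (j.succAbove l)))) =
        ((Equiv.Perm.sign σ : ℤˣ) : ℤ) • (w 0 * (List.ofFn fun k => u k * w k.succ).prod) := by
      rw [Finset.sum_eq_single (σ j)]
      · rw [Pi.single_eq_same, one_mul, map_zsmul, mul_smul_comm, ← List.prod_ofFn, map_list_prod,
          List.map_ofFn]
        simp only [hw, hτ, Equiv.Perm.mul_apply, Fin.cycleRange_symm_zero,
          Fin.cycleRange_symm_succ, Fin.cons_zero, Fin.cons_succ, hu]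
        rfl
      · intro k _ hk
        rw [Pi.single_eq_of_ne hk.symm, zero_mul, smul_zero, map_zero, mul_zero]
      · exact fun h => absurd (Finset.mem_univ _) h
    -- Sorting the positions (F t, τ t) by their second entry puts τ⁻¹ into the positions and sign τ
    -- in front; sign τ cancels sign σ up to (-1)^j.
    have h2 : φ ((List.ofFn u).prod * (List.ofFn w).prod) =
        positionDet ((finCongr rfl).trans finSumFinEquiv.symm) A
          (transversalPositions i j f τ⁻¹ ∘ Equiv.sumCongr 1 τ) := by
      rw [← List.prod_append, ← List.ofFn_fin_append]
      have h3 : Fin.append u w = fun t => ι K fun r => A r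
          ((transversalPositions i j f τ⁻¹ ∘ Equiv.sumCongr 1 τ)
            (((finCongr rfl).trans finSumFinEquiv.symm) t)).1
          ((transversalPositions i j f τ⁻¹ ∘ Equiv.sumCongr 1 τ)
            (((finCongr rfl).trans finSumFinEquiv.symm) t)).2 := by
        funext t
        refine Fin.addCases (fun k => ?_) (fun k => ?_) t
        · rw [Fin.append_left]
          simp [transversalPositions, hu, hx]
        · rw [Fin.append_right]
          simp [transversalPositions, hw, hx]
      rw [h3, hφ, positionDet]
    have h4 : Equiv.Perm.sign (Equiv.sumCongr (1 : Equiv.Perm (Fin m)) τ) =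
        Equiv.Perm.sign σ * (-1) ^ (j : ℕ) := by
      rw [← Fin.sign_cycleRange j, ← Equiv.Perm.sign_symm j.cycleRange, ← Equiv.Perm.sign_mul, ← hτ]
      exact (Equiv.Perm.sign_sumCongr 1 τ).trans (by rw [Equiv.Perm.sign_one, one_mul])
    have h5 : ∀ y : ExteriorAlgebra K (Fin (m + (m + 1)) → K), ∀ r,
        φ ((-1) ^ r * y) = (-1) ^ r * φ y := by
      intro y r
      rcases neg_one_pow_eq_or ℤ r with h | h
      · have h6 : ∀ (T : Type _) [Ring T], (-1 : T) ^ r = 1 := fun T _ => by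
          exact_mod_cast congrArg (Int.cast : ℤ → T) h
        rw [h6, h6, one_mul, one_mul]
      · have h6 : ∀ (T : Type _) [Ring T], (-1 : T) ^ r = -1 := fun T _ => by
          exact_mod_cast congrArg (Int.cast : ℤ → T) h
        rw [h6, h6, neg_one_mul, neg_one_mul, map_neg]
    rw [h1, mul_prod_ofFn_mul_of_anticommute u w fun k l => hanti _ _ _ _, map_zsmul, h5, h2,
      positionDet_comp_perm, h4, zsmul_eq_mul, pow_add]
    rcases Int.units_eq_one_or (Equiv.Perm.sign σ) with h | h <;> rw [h] <;> push_cast <;> ring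
  rw [show 2 * m + 1 = N by omega] at hpow
  rw [hpow, Matrix.smul_apply, Matrix.mul_apply, ← Int.cast_smul_eq_zsmul K, map_smul]
  simp only [RingHom.mapMatrix_apply, Matrix.map_apply, hadj, map_sum, Finset.mul_sum,
    Matrix.of_apply] at hterm ⊢
  have hswap : ∀ G : Fin (m + 1) → Equiv.Perm (Fin (m + 1)) → (Fin m → Fin (m + 1)) → K,
      ∑ k, ∑ σ, ∑ f, G k σ f = ∑ f, ∑ σ, ∑ k, G k σ f := by
    intro G
    exact Finset.sum_comm.trans
      ((Finset.sum_congr rfl fun σ _ => Finset.sum_comm).trans Finset.sum_comm)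
  rw [hswap, smul_eq_mul, Finset.mul_sum]
  refine Finset.sum_congr rfl fun f _ => ?_
  simp only [hterm, Finset.mul_sum]
  refine Fintype.sum_equiv ((Equiv.mulRight j.cycleRange.symm).trans (Equiv.inv _)) _ _ fun σ => ?_
  simp only [Equiv.trans_apply, Equiv.coe_mulRight, Equiv.inv_apply, pow_add]
  push_cast
  ring

/-! ### Weighted Cauchy–Binet and counting of rearrangements -/

/-- The Cauchy–Binet expansion in which the term of each column set carries a weight. -/
theorem sum_prod_mul_det_eq_sum_det_mul_det {K E : Type*} [CommRing K] [Fintype E] [DecidableEq E]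
    {N : ℕ} (P : Fin N → E → K) (Q : Fin N → E → K) (W : Finset E → K)
    (e : ∀ ν : {ν : Finset E // ν.card = N}, Fin N ≃ {x : E // x ∈ ν.1}) :
    ∑ w : Fin N → E, (∏ c, P c (w c)) *
        (W (Finset.univ.image w) * (Matrix.of fun t r => Q r (w t)).det) =
      ∑ ν : {ν : Finset E // ν.card = N}, (Matrix.of fun k c => P c (e ν k)).det * W ν.1 *
        (Matrix.of fun r c => Q r (e ν c)).det := by
  have himage : ∀ (ν : {ν : Finset E // ν.card = N}) (π : Equiv.Perm (Fin N)),
      Finset.univ.image (fun t => (e ν (π t)).1) = ν.1 := by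
    intro ν π
    ext x
    simp only [Finset.mem_image, Finset.mem_univ, true_and]
    refine ⟨fun ⟨t, ht⟩ => ht ▸ (e ν (π t)).2, fun hx => ⟨π.symm ((e ν).symm ⟨x, hx⟩), by simp⟩⟩
  have hsigma : ∀ F : (ν : {ν : Finset E // ν.card = N}) → Equiv.Perm (Fin N) → K,
      ∑ ν, ∑ π, F ν π = ∑ x : (_ : {ν : Finset E // ν.card = N}) × Equiv.Perm (Fin N), F x.1 x.2 :=
    fun F => (Fintype.sum_sigma' _).symm
  simp only [Matrix.det_apply' (Matrix.of fun k c => P c (e _ k)), Finset.sum_mul]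
  rw [hsigma]
  symm
  -- Injective words correspond to a set with a permutation of its chosen ordering. The weight sees
  -- only the set; words with a repetition have two equal rows.
  refine Fintype.sum_of_injective (fun x t => (e x.1 (x.2 t)).1) ?_ _ _ ?_ ?_
  · rintro ⟨ν, π⟩ ⟨ν', π'⟩ h
    have h1 : ν = ν' := by
      refine Subtype.ext ?_
      rw [← himage ν π, ← himage ν' π']
      exact congrArg (fun w => Finset.univ.image w) h
    subst h1
    have h2 : π = π' := by
      ext t : 1
      exact (e ν).injective (Subtype.ext (congrFun h t))
    rw [h2]
  · intro w hw
    by_cases hinj : Function.Injective w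
    · refine absurd ?_ hw
      set ν : {ν : Finset E // ν.card = N} := ⟨Finset.univ.image w, by
        rw [Finset.card_image_of_injective _ hinj, Finset.card_fin]⟩ with hν
      have hmem : ∀ t, w t ∈ ν.1 := fun t => Finset.mem_image_of_mem _ (Finset.mem_univ t)
      have hbij : Function.Bijective fun t => (e ν).symm ⟨w t, hmem t⟩ := by
        refine Finite.injective_iff_bijective.mp fun a b hab => hinj ?_
        exact congrArg Subtype.val ((e ν).symm.injective hab)
      refine ⟨⟨ν, Equiv.ofBijective _ hbij⟩, ?_⟩
      funext t
      simp
    · simp only [Function.Injective, not_forall] at hinj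
      obtain ⟨a, b, hab, hne⟩ := hinj
      rw [Matrix.det_zero_of_row_eq hne
        (funext fun c => by rw [Matrix.of_apply, Matrix.of_apply, hab]), mul_zero, mul_zero]
  · rintro ⟨ν, π⟩
    have h := Matrix.det_permute π (Matrix.of fun t r => Q r (e ν t).1)
    have h1 : (Matrix.of fun t r => Q r (e ν t).1).submatrix π id =
      Matrix.of fun t r => Q r (e ν (π t)).1 := rfl
    have h2 : (Matrix.of fun t r => Q r (e ν t).1).det =
        (Matrix.of fun r c => Q r (e ν c).1).det := by
      rw [← Matrix.det_transpose]
      rfl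
    rw [h1, h2] at h
    simp only [himage, h, Matrix.of_apply]
    ring

/-- The number of permutations that rearrange one finite family into another. -/
theorem card_perm_comp_eq {α β : Type*} [Fintype α] [DecidableEq α] [Fintype β] [DecidableEq β]
    (F g : α → β) :
    (Finset.univ.filter fun σ : Equiv.Perm α => F ∘ σ = g).card =
      if ∀ c, (Finset.univ.filter fun a => F a = c).card =
          (Finset.univ.filter fun a => g a = c).card then
        ∏ c, (Finset.univ.filter fun a => g a = c).card.factorial else 0 := by
  split_ifs with h
  · have hfib : ∀ c, Nonempty ({a // g a = c} ≃ {a // F a = c}) := fun c => by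
      rw [← Fintype.card_eq, Fintype.card_subtype, Fintype.card_subtype, h c]
    -- One solution τ makes the solution set a coset of the stabilizer of g, whose order is the
    -- product of factorials.
    set τ : Equiv.Perm α := Equiv.ofFiberEquiv fun c => (hfib c).some with hτ
    have hFτ : F ∘ τ = g := funext fun a => Equiv.ofFiberEquiv_map _ a
    have hstab := DomMulAct.stabilizer_card g
    simp only [Fintype.card_subtype] at hstab
    rw [← hstab]
    refine Finset.card_equiv (Equiv.mulLeft τ⁻¹) fun σ => ?_
    simp only [Finset.mem_filter, Finset.mem_univ, true_and, Equiv.coe_mulLeft]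
    have h1 : g ∘ (τ⁻¹ * σ : Equiv.Perm α) = F ∘ σ := by
      rw [← hFτ]
      funext a
      simp
    rw [h1]
  · rw [Finset.card_eq_zero, Finset.filter_eq_empty_iff]
    rintro σ - rfl
    refine h fun c => ?_
    refine (Finset.card_equiv σ fun a => ?_).symm
    simp

/-! ### Minors and weights of types -/

open Matrix in
-- Every row of M_ν sums to zero, so its maximal minors agree up to alternating signs.
theorem RankType.neg_one_pow_mul_det_incMinor {m : ℕ} (ν : RankType (m + 1)) (e : ν.Ordering)
    (s s' : Fin (2 * (m + 1))) :
    (-1) ^ (s : ℕ) * (ν.incMinor e s).det = (-1) ^ (s' : ℕ) * (ν.incMinor e s').det := by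
  have hskip : ∀ t : Fin (2 * (m + 1)),
      skipColumn (n := m + 1) t = Fin.succAbove (n := 2 * m + 1) t := by
    intro t
    funext c
    ext
    simp only [skipColumn, Fin.succAbove, Fin.lt_def, Fin.val_castSucc]
    split_ifs <;> rfl
  have h := submatrix_succAbove_det_eq_negOnePow_submatrix_succAbove_det' (n := 2 * m + 1)
    (ν.incMatrix e) (fun k => ?_) s s'
  · rw [← hskip, ← hskip] at h
    change (ν.incMinor e s).det = _ • (ν.incMinor e s').det at h
    rw [h, Units.smul_def, smul_eq_mul, ← mul_assoc, ← Int.coe_negOnePow_natCast,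
      ← Int.coe_negOnePow_natCast, ← Units.val_mul, ← Int.negOnePow_add]
    have h1 : Int.negOnePow (((s : ℕ) : ℤ) + (((s : ℕ) : ℤ) - ((s' : ℕ) : ℤ))) =
        Int.negOnePow ((s' : ℕ) : ℤ) := by
      rw [Int.negOnePow_eq_iff]
      exact ⟨s - s', by ring⟩
    rw [h1]
  · change ∑ c : Fin (2 * (m + 1)), ν.incMatrix e k c = 0
    have h1 : ∀ c : Fin (2 * (m + 1)), ν.incMatrix e k c =
        (if c = ⟨(e k).1.1, by omega⟩ then -1 else 0) +
          (if c = ⟨m + 1 + (e k).1.2, by omega⟩ then 1 else 0) := by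
      intro c
      have h2 := (e k).1.1.2
      simp only [RankType.incMatrix, Matrix.of_apply, Fin.ext_iff]
      split_ifs <;> first | rfl | omega
    simp only [h1, Finset.sum_add_distrib, Finset.sum_ite_eq', Finset.mem_univ, if_true]
    norm_num

/-- The weight of a set of positions: the product of factorials attached to it if its numbers of
pairs with given first and second entry are balanced, and zero otherwise. -/
def positionWeight {n : ℕ} (i j : Fin n) (S : Finset (Fin n × Fin n)) : ℕ :=
  if (fun a => ((S.filter fun x => x.1 = a).card : ℤ) - ((S.filter fun x => x.2 = a).card : ℤ)) =
      (Pi.single i 1 - Pi.single j 1 : Fin n → ℤ) then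
    ∏ r, intFactorial (((S.filter fun x => x.1 = r).card : ℤ) + (if j = r then 1 else 0) - 1)
  else 0

theorem card_filter_image_sumElim {m : ℕ} {β γ : Type*} [DecidableEq β] [DecidableEq γ]
    (u : Fin m → β) (v : Fin (m + 1) → β) (h : Function.Injective (Sum.elim u v)) (p : β → γ)
    (c : γ) :
    ((Finset.univ.image (Sum.elim u v)).filter fun x => p x = c).card =
      (Finset.univ.filter fun k => p (u k) = c).card +
        (Finset.univ.filter fun b => p (v b) = c).card := by
  rw [Finset.filter_image, Finset.card_image_of_injective _ h, Finset.card_filter,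
    Fintype.sum_sum_type, Finset.card_filter, Finset.card_filter]
  rfl

/-- Write F for `Fin.cons i f`. Then p_c = |g⁻¹(c)| + 1 - δ_{jc} and q_c = |F⁻¹(c)| + 1 - δ_{ic}.
Hence p - q = e_i - e_j says that F and g have fibres of equal size, and p_c + δ_{jc} - 1 is that
size. -/
theorem card_filter_perm_eq_positionWeight {m : ℕ} (i j : Fin (m + 1)) (f : Fin m → Fin (m + 1))
    (g : Fin (m + 1) → Fin (m + 1))
    (h : Function.Injective (Sum.elim (fun k => (j.succAbove k, f k)) (fun b => (g b, b)))) :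
    (Finset.univ.filter fun σ : Equiv.Perm (Fin (m + 1)) =>
      (Fin.cons i f : Fin (m + 1) → Fin (m + 1)) ∘ σ = g).card =
      positionWeight i j
        (Finset.univ.image (Sum.elim (fun k => (j.succAbove k, f k)) (fun b => (g b, b)))) := by
  have hone : ∀ c, (Finset.univ.filter fun b : Fin (m + 1) => b = c).card = 1 := fun c => by
    rw [Finset.filter_eq', if_pos (Finset.mem_univ _), Finset.card_singleton]
  have hp : ∀ c, (((Finset.univ.image (Sum.elim (fun k => (j.succAbove k, f k))
      (fun b => (g b, b)))).filter fun x => x.1 = c).card : ℤ) + (if j = c then 1 else 0) - 1 =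
      (Finset.univ.filter fun b => g b = c).card := by
    intro c
    have h1 := hone c
    rw [Finset.card_filter, Fin.sum_univ_succAbove _ j, ← Finset.card_filter] at h1
    rw [card_filter_image_sumElim _ _ h Prod.fst c]
    dsimp only
    zify at h1 ⊢
    linarith
  have hq : ∀ c, (((Finset.univ.image (Sum.elim (fun k => (j.succAbove k, f k))
      (fun b => (g b, b)))).filter fun x => x.2 = c).card : ℤ) + (if i = c then 1 else 0) - 1 =
      (Finset.univ.filter fun b => (Fin.cons i f : Fin (m + 1) → Fin (m + 1)) b = c).card := by
    intro c
    rw [card_filter_image_sumElim _ _ h Prod.snd c, hone c, Finset.card_filter _ Finset.univ,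
      Finset.card_filter _ Finset.univ, Fin.sum_univ_succ]
    simp only [Fin.cons_zero, Fin.cons_succ]
    push_cast
    ring
  rw [card_perm_comp_eq, positionWeight]
  congr 1
  · rw [funext_iff]
    refine propext (forall_congr' fun c => ?_)
    have h1 := hp c
    have h2 := hq c
    rw [Pi.sub_apply, Pi.single_apply, Pi.single_apply, ← @Nat.cast_inj ℤ, ← h1, ← h2,
      if_congr (eq_comm (a := c) (b := i)) rfl rfl, if_congr (eq_comm (a := c) (b := j)) rfl rfl]
    constructor <;> intro h3 <;> linarith
  · refine Finset.prod_congr rfl fun c _ => ?_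
    rw [hp, intFactorial, Int.toNat_natCast]

/-- The sum over permutations and functions as a sum over families of positions. -/
theorem sum_positionDet_transversalPositions {K : Type*} [CommRing K] {m N : ℕ}
    (κ : Fin N ≃ Fin m ⊕ Fin (m + 1)) (A : Fin N → Matrix (Fin (m + 1)) (Fin (m + 1)) K)
    (i j : Fin (m + 1)) :
    ∑ f : Fin m → Fin (m + 1), ∑ σ : Equiv.Perm (Fin (m + 1)),
        positionDet κ A (transversalPositions i j f σ) =
      ∑ w : Fin m ⊕ Fin (m + 1) → Fin (m + 1) × Fin (m + 1),
        if (∀ k, (w (Sum.inl k)).1 = j.succAbove k) ∧ ∀ b, (w (Sum.inr b)).2 = b then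
          (positionWeight i j (Finset.univ.image w) : K) * positionDet κ A w else 0 := by
  have h1 : ∀ f : Fin m → Fin (m + 1), ∑ σ : Equiv.Perm (Fin (m + 1)),
      positionDet κ A (transversalPositions i j f σ) = ∑ g : Fin (m + 1) → Fin (m + 1),
        (positionWeight i j (Finset.univ.image
          (Sum.elim (fun k => (j.succAbove k, f k)) (fun b => (g b, b)))) : K) *
        positionDet κ A (Sum.elim (fun k => (j.succAbove k, f k)) (fun b => (g b, b))) := by
    intro f
    rw [← Finset.sum_fiberwise (s := Finset.univ)
      (g := fun σ : Equiv.Perm (Fin (m + 1)) =>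
        (Fin.cons i f : Fin (m + 1) → Fin (m + 1)) ∘ σ)]
    refine Finset.sum_congr rfl fun g _ => ?_
    rw [Finset.sum_congr rfl (g := fun _ => positionDet κ A
      (Sum.elim (fun k => (j.succAbove k, f k)) (fun b => (g b, b)))), Finset.sum_const,
      nsmul_eq_mul]
    -- With a repeated position the count need not equal the weight, but the determinant is zero.
    · by_cases h : Function.Injective
        (Sum.elim (fun k => (j.succAbove k, f k)) (fun b => (g b, b)))
      · rw [card_filter_perm_eq_positionWeight i j f g h]
      · simp only [Function.Injective, not_forall] at h
        obtain ⟨a, b, hab, hne⟩ := h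
        have h0 : positionDet κ A
            (Sum.elim (fun k => (j.succAbove k, f k)) (fun b => (g b, b))) = 0 := by
          refine Matrix.det_zero_of_row_eq (i := κ.symm a) (j := κ.symm b)
            (fun h => hne (κ.symm.injective h)) (funext fun r => ?_)
          simp only [Matrix.of_apply, Equiv.apply_symm_apply, hab]
        rw [h0, mul_zero, mul_zero]
    · intro σ hσ
      rw [← (Finset.mem_filter.mp hσ).2]
      rfl
  simp only [h1]
  rw [← Fintype.sum_prod_type']
  refine Fintype.sum_of_injective (fun x : (Fin m → Fin (m + 1)) × (Fin (m + 1) → Fin (m + 1)) =>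
    Sum.elim (fun k => (j.succAbove k, x.1 k)) (fun b => (x.2 b, b))) ?_ _ _ ?_ ?_
  · rintro ⟨f, g⟩ ⟨f', g'⟩ h
    refine Prod.ext (funext fun k => ?_) (funext fun b => ?_)
    · exact congrArg Prod.snd (congrFun h (Sum.inl k))
    · exact congrArg Prod.fst (congrFun h (Sum.inr b))
  · intro w hw
    refine if_neg fun h => hw ⟨(fun k => (w (Sum.inl k)).2, fun b => (w (Sum.inr b)).1), ?_⟩
    funext t
    rcases t with k | b
    · exact Prod.ext (h.1 k).symm rfl
    · exact Prod.ext rfl (h.2 b).symm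
  · rintro ⟨f, g⟩
    rw [if_pos ⟨fun _ => rfl, fun _ => rfl⟩]

/-! ### Sums over types and reduction to generic matrices -/

/-- The signed sum over types of rank `n` attached to the column `s` and the entry `(i, j)`. -/
def typeSum {R : Type*} [CommRing R] {n : ℕ} (A : Fin (2 * n - 1) → Matrix (Fin n) (Fin n) R)
    (e : ∀ ν : RankType n, ν.Ordering) (s : Fin (2 * n)) (i j : Fin n) : R :=
  (-1) ^ (n.choose 2 + (s : ℕ)) *
    ∑ ν : RankType n with
        (fun a => (ν.p a : ℤ) - (ν.q a : ℤ)) =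
          (Pi.single i 1 - Pi.single j 1 : Fin n → ℤ),
      (((ν.incMinor (e ν) s).det : ℤ) : R) *
        ((∏ r : Fin n,
          intFactorial ((ν.p r : ℤ) + (if j = r then 1 else 0) - 1) : ℕ) : R) *
        (ν.entryMatrix (e ν) A).det

theorem map_antisymmetrisation {R S : Type*} [CommRing R] [CommRing S] (φ : R →+* S) {n k : ℕ}
    (A : Fin k → Matrix (Fin n) (Fin n) R) (i j : Fin n) :
    φ (antisymmetrisation A i j) = antisymmetrisation (fun r => φ.mapMatrix (A r)) i j := by
  have h : φ.mapMatrix (antisymmetrisation A) = antisymmetrisation fun r => φ.mapMatrix (A r) := by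
    simp only [antisymmetrisation, map_sum, map_zsmul, map_list_prod, List.map_ofFn]
    rfl
  rw [← h]
  rfl

theorem map_typeSum {R S : Type*} [CommRing R] [CommRing S] (φ : R →+* S) {n : ℕ}
    (A : Fin (2 * n - 1) → Matrix (Fin n) (Fin n) R) (e : ∀ ν : RankType n, ν.Ordering)
    (s : Fin (2 * n)) (i j : Fin n) :
    φ (typeSum A e s i j) = typeSum (fun r => φ.mapMatrix (A r)) e s i j := by
  simp only [typeSum, map_mul, map_pow, map_neg, map_one, map_sum, map_intCast, map_natCast,
    RingHom.map_det]
  rfl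

theorem typeSum_eq_typeSum {R : Type*} [CommRing R] {m : ℕ}
    (A : Fin (2 * (m + 1) - 1) → Matrix (Fin (m + 1)) (Fin (m + 1)) R)
    (e : ∀ ν : RankType (m + 1), ν.Ordering) (s s' : Fin (2 * (m + 1))) (i j : Fin (m + 1)) :
    typeSum A e s i j = typeSum A e s' i j := by
  simp only [typeSum, Finset.mul_sum]
  refine Finset.sum_congr rfl fun ν _ => ?_
  have h := congrArg (Int.cast : ℤ → R) (ν.neg_one_pow_mul_det_incMinor (e ν) s s')
  simp only [Int.cast_mul, Int.cast_pow, Int.cast_neg, Int.cast_one] at h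
  rw [pow_add, pow_add]
  linear_combination (-1) ^ (m + 1).choose 2 *
    (((∏ r : Fin (m + 1), intFactorial ((ν.p r : ℤ) + (if j = r then 1 else 0) - 1) : ℕ) : R) *
        (ν.entryMatrix (e ν) A).det) * h

theorem antisymmetrisation_eq_typeSum_of_rat {K : Type*} [CommRing K] [Algebra ℚ K] {m : ℕ}
    (A : Fin (2 * (m + 1) - 1) → Matrix (Fin (m + 1)) (Fin (m + 1)) K)
    (e : ∀ ν : RankType (m + 1), ν.Ordering) (s : Fin (2 * (m + 1))) (i j : Fin (m + 1)) :
    antisymmetrisation A i j = typeSum A e s i j := by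
  have hN : m + (m + 1) = 2 * (m + 1) - 1 := by omega
  -- Deleting column j leaves exactly the columns `j.succAbove k` and n + b, which match the two
  -- families in `transversalPositions`.
  rw [typeSum_eq_typeSum A e s ⟨j, by omega⟩,
    antisymmetrisation_eq_sum_transversalPositions hN, sum_positionDet_transversalPositions,
    typeSum, pow_add _ _ m, mul_assoc]
  set κ := (finCongr hN.symm).trans finSumFinEquiv.symm with hκ
  congr 1
  set P : Fin (2 * (m + 1) - 1) → Fin (m + 1) × Fin (m + 1) → K := fun c x =>
    Sum.elim (fun k => if x.1 = j.succAbove k then -1 else 0) (fun b => if x.2 = b then 1 else 0)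
      (κ c) with hP
  have hCB := sum_prod_mul_det_eq_sum_det_mul_det P (fun r x => A r x.1 x.2)
    (fun S => (positionWeight i j S : K)) e
  have hminor : ∀ ν : RankType (m + 1), (Matrix.of fun k c => P c (e ν k)).det =
      (((ν.incMinor (e ν) ⟨j, by omega⟩).det : ℤ) : K) := by
    intro ν
    rw [Int.cast_det]
    congr 1
    ext k c
    obtain ⟨t, rfl⟩ := κ.symm.surjective c
    have h1 := (e ν k).1.1.2
    have h2 := (e ν k).1.2.2
    have h3 := j.2
    simp only [hP, Matrix.of_apply, Equiv.apply_symm_apply, Matrix.map_apply, RankType.incMinor,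
      RankType.incMatrix, Matrix.submatrix_apply, id_eq]
    rcases t with l | b
    · have h4 : ((skipColumn (⟨j, by omega⟩ : Fin (2 * (m + 1))) (κ.symm (Sum.inl l)) : ℕ)) =
          (j.succAbove l : ℕ) := by
        simp only [hκ, skipColumn, Fin.succAbove, Fin.lt_def, Equiv.symm_trans_apply,
          Equiv.symm_symm, finSumFinEquiv_apply_left, finCongr_symm, finCongr_apply,
          Fin.val_cast, Fin.val_castAdd, Fin.val_castSucc]
        split_ifs <;> simp
      have h5 := (j.succAbove l).2
      simp only [h4, Sum.elim_inl, Fin.ext_iff, eq_comm (b := (j.succAbove l : ℕ))]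
      split_ifs <;> first | omega | simp
    · have h4 : ((skipColumn (⟨j, by omega⟩ : Fin (2 * (m + 1))) (κ.symm (Sum.inr b)) : ℕ)) =
          m + 1 + b := by
        simp only [hκ, skipColumn, Equiv.symm_trans_apply,
          Equiv.symm_symm, finSumFinEquiv_apply_right, finCongr_symm, finCongr_apply,
          Fin.val_cast, Fin.val_natAdd]
        split_ifs <;> simp <;> omega
      simp only [h4, Sum.elim_inr, Fin.ext_iff]
      split_ifs <;> first | omega | simp
  -- Each of the m columns with entries -1 contributes a sign; otherwise the product is the
  -- indicator of the constraint on the positions.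
  have hprod : ∀ w : Fin m ⊕ Fin (m + 1) → Fin (m + 1) × Fin (m + 1),
      ∏ c, P c (w (κ c)) = (-1) ^ m *
        if (∀ k, (w (Sum.inl k)).1 = j.succAbove k) ∧ ∀ b, (w (Sum.inr b)).2 = b then 1 else 0 := by
    intro w
    rw [Fintype.prod_equiv κ _ (fun t => Sum.elim
      (fun k => if (w t).1 = j.succAbove k then (-1 : K) else 0)
      (fun b => if (w t).2 = b then 1 else 0) t) fun c => rfl, Fintype.prod_sum_type]
    simp only [Sum.elim_inl, Sum.elim_inr]
    have h1 : ∀ k, (if (w (Sum.inl k)).1 = j.succAbove k then (-1 : K) else 0) =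
        -1 * if (w (Sum.inl k)).1 = j.succAbove k then 1 else 0 := fun k => by
      rw [mul_ite, mul_one, mul_zero]
    simp only [h1, Finset.prod_mul_distrib, Finset.prod_const, Finset.card_fin,
      Finset.prod_ite_zero, Finset.mem_univ, true_imp_iff, mul_assoc]
    rw [ite_and]
    split_ifs <;> simp
  rw [Finset.sum_filter]
  trans ∑ ν : RankType (m + 1), (Matrix.of fun k c => P c (e ν k)).det *
    (positionWeight i j ν.1 : K) * (Matrix.of fun r c => A r (e ν c).1.1 (e ν c).1.2).det
  · rw [← hCB, Finset.mul_sum]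
    refine Fintype.sum_equiv (κ.symm.arrowCongr (Equiv.refl _)) _ _ fun w => ?_
    have h1 : κ.symm.arrowCongr (Equiv.refl _) w = w ∘ κ := by
      funext c
      simp
    have h2 : Finset.univ.image (w ∘ κ) = Finset.univ.image w := by
      rw [← Finset.image_image, Finset.image_univ_equiv]
    rw [h1, h2]
    simp only [Function.comp_apply]
    rw [hprod, positionDet, mul_assoc, ite_mul, one_mul, zero_mul]
  · refine Finset.sum_congr rfl fun ν _ => ?_
    rw [hminor, positionWeight]
    change _ * ((if (fun a => (ν.p a : ℤ) - (ν.q a : ℤ)) =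
      (Pi.single i 1 - Pi.single j 1 : Fin (m + 1) → ℤ) then _ else _ : ℕ) : K) *
        (ν.entryMatrix (e ν) A).det = _
    split_ifs
    · rfl
    · rw [Nat.cast_zero, mul_zero, zero_mul]

theorem mainTheorem12 {R : Type*} [CommRing R] (n : ℕ)
    (A : Fin (2 * n - 1) → Matrix (Fin n) (Fin n) R)
    (e : ∀ ν : RankType n, ν.Ordering)
    (s : Fin (2 * n)) (i j : Fin n) :
    antisymmetrisation A i j =
      (-1) ^ (n.choose 2 + (s : ℕ)) *
        ∑ ν : RankType n with
            (fun a => (ν.p a : ℤ) - (ν.q a : ℤ)) =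
              (Pi.single i 1 - Pi.single j 1 : Fin n → ℤ),
          (((ν.incMinor (e ν) s).det : ℤ) : R) *
            ((∏ r : Fin n,
              intFactorial ((ν.p r : ℤ) + (if j = r then 1 else 0) - 1) : ℕ) : R) *
            (ν.entryMatrix (e ν) A).det := by
  obtain _ | m := n
  · exact i.elim0
  change antisymmetrisation A i j = typeSum A e s i j
  set G : Fin (2 * (m + 1) - 1) → Matrix (Fin (m + 1)) (Fin (m + 1))
      (MvPolynomial (Fin (2 * (m + 1) - 1) × Fin (m + 1) × Fin (m + 1)) ℤ) :=
    fun r => Matrix.of fun a b => MvPolynomial.X (r, a, b) with hG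
  have hgen : antisymmetrisation G i j = typeSum G e s i j := by
    -- Both sides commute with ring homomorphisms, so the generic identity over ℤ may be checked
    -- over ℚ, where the torsion argument applies, and then specialised to R.
    apply MvPolynomial.map_injective (Int.castRingHom ℚ) (RingHom.injective_int _)
    rw [map_antisymmetrisation, map_typeSum]
    exact antisymmetrisation_eq_typeSum_of_rat _ e s i j
  have hA : A = fun r => (MvPolynomial.eval₂Hom (Int.castRingHom R)
      fun x => A x.1 x.2.1 x.2.2).mapMatrix (G r) := by
    funext r
    ext a b
    simp [hG]
  rw [hA, ← map_antisymmetrisation, ← map_typeSum, hgen]
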